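/- For $|q|<1$ (or as formal power series in $q$) write $(a;p)_\infty=\prod_{n\ge 0}(1-ap^n)$ and $(a,b;p)_\infty=(a;p)_\infty(b;p)_\infty$. For integers $0<r<t$ and $0<s<2t$ define integers $g_{r,s,t}(n)$ and $h_{r,s,t}(n)$ by $$(-q^r,-q^{t-r};q^t)_\infty^3\,(q^s,q^{2t-s};q^{2t})_\infty=\sum_{n=0}^\infty g_{r,s,t}(n)q^n,$$ $$(-q^r,-q^{t-r};q^t)_\infty\,(q^s,q^{2t-s};q^{2t})_\infty^3=\sum_{n=0}^\infty h_{r,s,t}(n)q^n.$$ Then for every integer $n\ge 0$: \begin{align*} g_{1,2,5}(5n+1)&=g_{2,4,5}(5n+2), & g_{1,2,5}(5n+3)&=-g_{2,4,5}(5n+4),\\ g_{1,3,5}(5n)&=g_{2,1,5}(5n), & g_{1,3,5}(5n+2)&=g_{2,1,5}(5n+2),\\ h_{1,1,5}(5n)&=h_{2,3,5}(5n+2), & h_{1,1,5}(5n+1)&=h_{2,3,5}(5n+3),\\ h_{1,4,5}(5n+1)&=h_{2,2,5}(5n), & h_{1,4,5}(5n+2)&=-h_{2,2,5}(5n+1).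 \end{align*} -/

import Mathlib

open PowerSeries
open scoped PowerSeries.WithPiTopology

noncomputable section

/-- `(a; p)_∞ = ∏_{n ≥ 0} (1 - a pⁿ)` for formal power series `a`, `p` in the variable `q = X` with
integer coefficients. The product is the limit for coefficientwise convergence; it converges
whenever `p` has zero constant term (see `multipliable_qPoch`). -/
def qPoch (a p : ℤ⟦X⟧) : ℤ⟦X⟧ := ∏' n : ℕ, (1 - a * p ^ n)

/-- `(a, b; p)_∞ = (a; p)_∞ (b; p)_∞`. -/
def qPoch₂ (a b p : ℤ⟦X⟧) : ℤ⟦X⟧ := qPoch a p * qPoch b p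

theorem multipliable_qPoch (a p : ℤ⟦X⟧) (hp : constantCoeff p = 0) :
    Multipliable fun n : ℕ => 1 - a * p ^ n := by
  simp_rw [sub_eq_add_neg]
  apply PowerSeries.WithPiTopology.multipliable_one_add_of_tendsto_order_atTop_nhds_top
  refine ENat.tendsto_nhds_top_iff_natCast_lt.mpr fun n =>
    Filter.eventually_atTop.mpr ⟨n + 1, fun m hm => ?_⟩
  rw [order_neg]
  have h1 : (m : ℕ∞) ≤ (a * p ^ m).order := by
    apply le_order
    intro i hi
    have hd : (X : ℤ⟦X⟧) ^ m ∣ a * p ^ m :=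
      Dvd.dvd.mul_left (pow_dvd_pow_of_dvd (X_dvd_iff.mpr hp) m) a
    exact X_pow_dvd_iff.mp hd i (by exact_mod_cast hi)
  refine lt_of_lt_of_le ?_ h1
  exact_mod_cast hm

/-- The coefficient `g_{r,s,t}(n)` of `qⁿ` in `(-q^r, -q^{t-r}; q^t)_∞³ (q^s, q^{2t-s}; q^{2t})_∞`,
for `0 < r < t` and `0 < s < 2t`. -/
def gCoeff (r s t n : ℕ) : ℤ :=
  coeff n ((qPoch₂ (-(X ^ r)) (-(X ^ (t - r))) (X ^ t)) ^ 3 *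
    qPoch₂ (X ^ s) (X ^ (2 * t - s)) (X ^ (2 * t)))

/-- The coefficient `h_{r,s,t}(n)` of `qⁿ` in `(-q^r, -q^{t-r}; q^t)_∞ (q^s, q^{2t-s}; q^{2t})_∞³`,
for `0 < r < t` and `0 < s < 2t`. -/
def hCoeff (r s t n : ℕ) : ℤ :=
  coeff n (qPoch₂ (-(X ^ r)) (-(X ^ (t - r))) (X ^ t) *
    (qPoch₂ (X ^ s) (X ^ (2 * t - s)) (X ^ (2 * t))) ^ 3)

end

/-! By the Jacobi triple product, each product here is a theta series times a factor depending only
on the base, a power series in `X ^ 5` or `X ^ 10`. The total factor is therefore a series in `X ^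
5`, common to both sides of each identity. Multiplying by it never mixes residue classes of
exponents mod 5, so it suffices to compare the quadruple theta series one class at a time
(`coeff_expand_mul_eq_of_coeff_eq`).

There a coefficient is a signed count of points `(a, b, c, d)` of ℤ⁴ on a level set of `quadForm`.
Mod 5 the squares vanish, and fixing the exponent's class fixes a linear form in `a, b, c, d` mod 5.
This is exactly what makes an affine isometry integral: the reflection in `v = (1, 1, 1, ±1)` (for
`g`) or `v = (1, 1, 1, ±2)` (for `h`), up to sign changes of coordinates. It has denominator 5 in
general, but carries the chosen class of one series onto that of the other and multiplies all signs
by one constant, whence the ± in each identity. -/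

noncomputable section

/-! ### Gaussian binomials and the finite triple product. -/

section GaussBinom

variable {R : Type*} [CommRing R]

/-- The Gaussian binomial coefficient `[n, k]_p`. -/
def gaussBinom (p : R) : ℕ → ℕ → R
  | _, 0 => 1
  | 0, _ + 1 => 0
  | n + 1, k + 1 => gaussBinom p n k + p ^ (k + 1) * gaussBinom p n (k + 1)

@[simp]
theorem gaussBinom_zero_right (p : R) (n : ℕ) : gaussBinom p n 0 = 1 := by
  cases n <;> rfl

theorem gaussBinom_succ_succ (p : R) (n k : ℕ) :
    gaussBinom p (n + 1) (k + 1) = gaussBinom p n k + p ^ (k + 1) * gaussBinom p n (k + 1) := rfl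

theorem gaussBinom_eq_zero_of_lt (p : R) {n k : ℕ} (h : n < k) : gaussBinom p n k = 0 := by
  induction n generalizing k with
  | zero => obtain ⟨k, rfl⟩ := Nat.exists_eq_add_of_lt h; rfl
  | succ n ih =>
    obtain ⟨k, rfl⟩ : ∃ k', k = k' + 1 := ⟨k - 1, by omega⟩
    rw [gaussBinom_succ_succ, ih (by omega), ih (by omega)]
    simp

/-- The second Pascal rule. Having both rules lets the finite triple product be proved without
dividing by factors `1 - p ^ i`. -/
theorem gaussBinom_succ_succ' (p : R) {n k : ℕ} (h : k ≤ n) :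
    gaussBinom p (n + 1) (k + 1) = gaussBinom p n (k + 1) + p ^ (n - k) * gaussBinom p n k := by
  induction n generalizing k with
  | zero =>
    obtain rfl : k = 0 := by omega
    simp [gaussBinom]
  | succ n ih =>
    rw [gaussBinom_succ_succ]
    rcases k with _ | k
    · rcases Nat.eq_zero_or_pos n with rfl | hn
      · simp [gaussBinom]
      · have h1 := ih (k := 0) (by omega)
        have h2 := gaussBinom_succ_succ p n 0
        simp only [gaussBinom_zero_right, Nat.sub_zero, zero_add] at *
        linear_combination p * h1 - h2
    · have hk : k ≤ n := by omega
      rw [gaussBinom_succ_succ p n (k + 1), show n + 1 - (k + 1) = n - k by omega]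
      have h1 := ih hk
      have h3 := gaussBinom_succ_succ p n k
      rcases hk.eq_or_lt with rfl | hlt
      · simp [gaussBinom_eq_zero_of_lt p (show k < k + 1 by omega),
          gaussBinom_eq_zero_of_lt p (show k < k + 2 by omega)]
      · have h2 := ih (k := k + 1) (by omega)
        have h4 := gaussBinom_succ_succ p n (k + 1)
        obtain ⟨m, rfl⟩ : ∃ m, n = k + 1 + m := ⟨n - (k + 1), by omega⟩
        rw [show k + 1 + m - (k + 1) = m by omega] at h2
        rw [show k + 1 + m - k = m + 1 by omega] at h1 ⊢
        linear_combination h1 + p ^ (k + 2) * h2 - p ^ (m + 1) * h3 - p ^ (k + 2) * h4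

theorem map_gaussBinom {S : Type*} [CommRing S] (φ : R →+* S) (p : R) (n k : ℕ) :
    φ (gaussBinom p n k) = gaussBinom (φ p) n k := by
  induction n generalizing k with
  | zero => cases k <;> simp [gaussBinom]
  | succ n ih => cases k <;> simp [gaussBinom, ih]

theorem sum_gaussBinom_succ_mul (p : R) (n : ℕ) (f : ℕ → R) :
    ∑ i ∈ Finset.range (n + 2), gaussBinom p (n + 1) i * f i =
      ∑ i ∈ Finset.range (n + 1), gaussBinom p n i * (p ^ i * f i + f (i + 1)) := by
  rw [Finset.sum_range_succ']
  simp_rw [gaussBinom_succ_succ, add_mul, mul_add, Finset.sum_add_distrib]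
  have h := Finset.sum_range_succ' (fun i => gaussBinom p n i * (p ^ i * f i)) (n + 1)
  rw [Finset.sum_range_succ, gaussBinom_eq_zero_of_lt p (Nat.lt_succ_self n)] at h
  simp only [gaussBinom_zero_right, pow_zero, one_mul, zero_mul, add_zero] at h ⊢
  rw [h, add_comm (∑ i ∈ Finset.range (n + 1), gaussBinom p n i * f (i + 1)), add_right_comm]
  congr 2
  exact Finset.sum_congr rfl fun i _ => by ring

theorem sum_gaussBinom_succ_mul' (p : R) (n : ℕ) (f : ℕ → R) :
    ∑ i ∈ Finset.range (n + 2), gaussBinom p (n + 1) i * f i =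
      ∑ i ∈ Finset.range (n + 1), gaussBinom p n i * (f i + p ^ (n - i) * f (i + 1)) := by
  rw [Finset.sum_range_succ']
  have h := Finset.sum_range_succ' (fun i => gaussBinom p n i * f i) (n + 1)
  rw [Finset.sum_range_succ, gaussBinom_eq_zero_of_lt p (Nat.lt_succ_self n)] at h
  simp only [gaussBinom_zero_right, one_mul, zero_mul, add_zero] at h ⊢
  simp_rw [mul_add, Finset.sum_add_distrib, h]
  rw [add_right_comm, ← Finset.sum_add_distrib]
  congr 1
  refine Finset.sum_congr rfl fun i hi => ?_
  rw [gaussBinom_succ_succ' p (by simpa [Nat.lt_succ_iff] using hi)]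
  ring

/-- The triangular number `j (j + 1) / 2` of an integer `j`. -/
def triangular (j : ℤ) : ℕ := (j * (j + 1) / 2).toNat

theorem two_mul_triangular (j : ℤ) : 2 * (triangular j : ℤ) = j * (j + 1) := by
  have h0 : 0 ≤ j * (j + 1) := by
    rcases le_or_gt 0 j with h | h
    · positivity
    · exact mul_nonneg_of_nonpos_of_nonpos (by omega) (by omega)
  rw [triangular, Int.toNat_of_nonneg (by omega)]
  exact Int.mul_ediv_cancel' (Int.even_mul_succ_self j).two_dvd

/-- The general term `z ^ (j (j + 1) / 2) * w ^ (j (j - 1) / 2)` of Ramanujan's theta series. -/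
def thetaTerm (z w : R) (j : ℤ) : R := z ^ triangular j * w ^ triangular (j - 1)

/-- Quasi-periodicity of theta terms: consecutive terms have ratio `z * (z * w) ^ j`. The exponents
`n`, `m` absorb a possibly negative `j`. -/
theorem mul_thetaTerm_of_eq {z w : R} {n m : ℕ} {j : ℤ} (h : (n : ℤ) = m + j) :
    z * (z * w) ^ n * thetaTerm z w j = (z * w) ^ m * thetaTerm z w (j + 1) := by
  have h1 := two_mul_triangular j
  have h2 := two_mul_triangular (j - 1)
  have h3 := two_mul_triangular (j + 1)
  have e1 : 1 + n + triangular j = m + triangular (j + 1) := by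
    zify; linarith
  have e2 : n + triangular (j - 1) = m + triangular j := by
    zify; linarith
  simp only [thetaTerm, add_sub_cancel_right]
  calc _ = z ^ (1 + n + triangular j) * w ^ (n + triangular (j - 1)) := by ring
    _ = _ := by rw [e1, e2]; ring

theorem mul_thetaTerm_of_eq' {z w : R} {n m : ℕ} {j : ℤ} (h : (m : ℤ) = n + j) :
    w * (z * w) ^ n * thetaTerm z w j = (z * w) ^ m * thetaTerm z w (j - 1) := by
  have h1 := two_mul_triangular j
  have h2 := two_mul_triangular (j - 1)
  have h3 := two_mul_triangular (j - 1 - 1)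
  have e1 : n + triangular j = m + triangular (j - 1) := by
    zify; linarith
  have e2 : 1 + n + triangular (j - 1) = m + triangular (j - 1 - 1) := by
    zify; linarith
  simp only [thetaTerm]
  calc _ = z ^ (n + triangular j) * w ^ (1 + n + triangular (j - 1)) := by ring
    _ = _ := by rw [e1, e2]; ring

/-- The finite form of the Jacobi triple product identity. -/
theorem finite_jacobi_triple_product (z w : R) (n : ℕ) :
    ∏ k ∈ Finset.range n, ((1 + z * (z * w) ^ k) * (1 + w * (z * w) ^ k)) =
      ∑ i ∈ Finset.range (2 * n + 1), gaussBinom (z * w) (2 * n) i * thetaTerm z w (i - n) := by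
  induction n with
  | zero => simp [thetaTerm, triangular]
  | succ n ih =>
    rw [Finset.prod_range_succ, ih, show 2 * (n + 1) = 2 * n + 1 + 1 by ring,
      sum_gaussBinom_succ_mul (z * w) (2 * n + 1) fun i => thetaTerm z w (i - (n + 1 : ℕ)),
      ← mul_assoc]
    -- The factor with `z` raises `2 * n` to `2 * n + 1` by the second Pascal rule; the factor with
    -- `w` then gives `2 * n + 2` by the first.
    have h : (∑ i ∈ Finset.range (2 * n + 1), gaussBinom (z * w) (2 * n) i *
        thetaTerm z w (i - n)) * (1 + z * (z * w) ^ n) =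
        ∑ i ∈ Finset.range (2 * n + 2), gaussBinom (z * w) (2 * n + 1) i *
          thetaTerm z w (i - n) := by
      rw [sum_gaussBinom_succ_mul' (z * w) (2 * n) fun i => thetaTerm z w (i - n),
        Finset.sum_mul]
      refine Finset.sum_congr rfl fun i hi => ?_
      have hi' := Finset.mem_range.mp hi
      have := mul_thetaTerm_of_eq (z := z) (w := w) (n := n) (m := 2 * n - i) (j := i - n)
        (by omega)
      rw [show ((i + 1 : ℕ) : ℤ) - n = i - n + 1 by push_cast; ring, ← this]
      ring
    rw [h, Finset.sum_mul]
    refine Finset.sum_congr rfl fun i _ => ?_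
    have := mul_thetaTerm_of_eq' (z := z) (w := w) (n := n) (m := i) (j := i - n) (by omega)
    rw [show ((i + 1 : ℕ) : ℤ) - (n + 1 : ℕ) = i - n by push_cast; ring,
      show (i : ℤ) - (n + 1 : ℕ) = i - n - 1 by push_cast; ring, ← this]
    ring

theorem pow_natAbs_dvd_thetaTerm {x z w : R} (hz : x ∣ z) (hw : x ∣ w) (j : ℤ) :
    x ^ j.natAbs ∣ thetaTerm z w j := by
  have h : j.natAbs ≤ triangular j + triangular (j - 1) := by
    have h1 := two_mul_triangular j
    have h2 := two_mul_triangular (j - 1)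
    have h3 : (j.natAbs : ℤ) ≤ (j.natAbs : ℤ) * j.natAbs := by
      exact_mod_cast Nat.le_mul_self _
    rw [Int.natAbs_mul_self'] at h3
    zify
    rw [Int.natCast_natAbs] at h3
    linarith
  refine (pow_dvd_pow x h).trans ?_
  rw [pow_add]
  exact mul_dvd_mul (pow_dvd_pow_of_dvd hz _) (pow_dvd_pow_of_dvd hw _)

/-- Walk from `(2 * M, M)` diagonally until the lower index is `k`, then raise the upper index. By
the two Pascal rules each step changes the value by a multiple of `p ^ M`. -/
theorem pow_dvd_gaussBinom_sub (p : R) {M n k : ℕ} (hk : M ≤ k) (hn : M + k ≤ n) :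
    p ^ M ∣ gaussBinom p n k - gaussBinom p (2 * M) M := by
  have left (n k : ℕ) (hk : M ≤ k) (h : M + k ≤ n) :
      p ^ M ∣ gaussBinom p (n + 1) k - gaussBinom p n k := by
    rcases k with _ | k
    · simp
    · rw [gaussBinom_succ_succ' p (by omega), add_sub_cancel_left]
      exact Dvd.dvd.mul_right (pow_dvd_pow p (by omega)) _
  have diag (n k : ℕ) (hk : M ≤ k) :
      p ^ M ∣ gaussBinom p (n + 1) (k + 1) - gaussBinom p n k := by
    rw [gaussBinom_succ_succ, add_sub_cancel_left]
    exact Dvd.dvd.mul_right (pow_dvd_pow p (by omega)) _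
  obtain ⟨a, rfl⟩ := Nat.exists_eq_add_of_le hk
  obtain ⟨b, rfl⟩ := Nat.exists_eq_add_of_le hn
  induction b with
  | zero =>
    induction a with
    | zero => simp [two_mul]
    | succ a ih =>
      have := dvd_add (diag (M + (M + a)) (M + a) (by omega)) (ih (by omega) (by omega))
      simpa [add_assoc] using this
  | succ b ih =>
    have := dvd_add (left (M + (M + a) + b) (M + a) (by omega) (by omega)) (ih (by omega))
    simpa [add_assoc] using this

end GaussBinom

/-! ### Passage to the limit in the triple product. -/

section JacobiTripleProduct

open Filter Topology

/-- The limit of `[n, k]_q` as both `k` and `n - k` tend to infinity. -/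
def gaussLimit : ℤ⟦X⟧ :=
  mk fun d => coeff d (gaussBinom (X : ℤ⟦X⟧) (2 * (d + 1)) (d + 1))

theorem X_pow_dvd_gaussBinom_sub_gaussLimit {M n k : ℕ} (hk : M ≤ k) (hn : M + k ≤ n) :
    (X : ℤ⟦X⟧) ^ M ∣ gaussBinom X n k - gaussLimit := by
  rw [X_pow_dvd_iff]
  intro d hd
  rw [map_sub, gaussLimit, coeff_mk, ← map_sub]
  exact X_pow_dvd_iff.mp (pow_dvd_gaussBinom_sub (X : ℤ⟦X⟧) (M := d + 1) (by omega) (by omega)) d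
    (by omega)

theorem tendsto_zero_of_X_pow_dvd {u : ℕ → ℤ⟦X⟧} (h : ∀ n, X ^ n ∣ u n) :
    Tendsto u atTop (𝓝 0) := by
  rw [WithPiTopology.tendsto_iff_coeff_tendsto]
  intro d
  refine tendsto_atTop_of_eventually_const (i₀ := d + 1) fun n hn => ?_
  rw [map_zero]
  exact X_pow_dvd_iff.mp (h n) d (by omega)

theorem sum_range_eq_sum_Icc_neg {M : Type*} [AddCommMonoid M] (f : ℤ → M) (n : ℕ) :
    ∑ i ∈ Finset.range (2 * n + 1), f (i - n) = ∑ j ∈ Finset.Icc (-n : ℤ) n, f j := by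
  refine Finset.sum_bij' (fun i _ => (i : ℤ) - n) (fun j _ => (j + n).toNat) ?_ ?_ ?_ ?_ ?_
  · intro i hi
    rw [Finset.mem_range] at hi
    rw [Finset.mem_Icc]
    omega
  · intro j hj
    rw [Finset.mem_Icc] at hj
    rw [Finset.mem_range]
    omega
  · intro i _
    omega
  · intro j hj
    rw [Finset.mem_Icc] at hj
    omega
  · intro i _
    rfl

/-- The Jacobi triple product identity, up to a factor that depends on `t` only. -/
theorem qPoch₂_eq_gaussLimit_mul {t : ℕ} (ht : t ≠ 0) {z w T : ℤ⟦X⟧} (hzw : z * w = X ^ t)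
    (hz : X ∣ z) (hw : X ∣ w) (hT : HasSum (thetaTerm z w) T) :
    qPoch₂ (-z) (-w) (X ^ t) = expand t ht gaussLimit * T := by
  have hconst : constantCoeff ((X : ℤ⟦X⟧) ^ t) = 0 := by simp [ht]
  have hprod : Tendsto (fun n => ∏ k ∈ Finset.range n,
      ((1 + z * (z * w) ^ k) * (1 + w * (z * w) ^ k))) atTop (𝓝 (qPoch₂ (-z) (-w) (X ^ t))) := by
    have h1 := (multipliable_qPoch (-z) _ hconst).hasProd.tendsto_prod_nat
    have h2 := (multipliable_qPoch (-w) _ hconst).hasProd.tendsto_prod_nat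
    refine (h1.mul h2).congr fun n => ?_
    rw [← Finset.prod_mul_distrib, hzw]
    exact Finset.prod_congr rfl fun k _ => by ring
  have hsum : Tendsto (fun n : ℕ => expand t ht gaussLimit *
      ∑ j ∈ Finset.Icc (-n : ℤ) n, thetaTerm z w j) atTop
      (𝓝 (expand t ht gaussLimit * T)) :=
    (hT.comp ((Finset.tendsto_Icc_neg_atTop_atTop (α := ℤ)).comp tendsto_natCast_atTop_atTop)
      ).const_mul _
  -- With `j = i - n`, the binomial is within `X ^ (n - |j|)` of its limit and the theta term is
  -- divisible by `X ^ |j|`, so the whole error is divisible by `X ^ n`.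
  have hdiff : Tendsto (fun n : ℕ => ∑ i ∈ Finset.range (2 * n + 1),
      (gaussBinom (z * w) (2 * n) i - expand t ht gaussLimit) * thetaTerm z w (i - n)) atTop
      (𝓝 0) := by
    refine tendsto_zero_of_X_pow_dvd fun n => Finset.dvd_sum fun i hi => ?_
    have hi' := Finset.mem_range.mp hi
    obtain ⟨M, hM⟩ : ∃ M, M + (i - n : ℤ).natAbs = n := ⟨n - (i - n : ℤ).natAbs, by omega⟩
    have h1 : (X : ℤ⟦X⟧) ^ M ∣ gaussBinom (z * w) (2 * n) i - expand t ht gaussLimit := by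
      have h := map_dvd (expand t ht)
        (X_pow_dvd_gaussBinom_sub_gaussLimit (M := M) (n := 2 * n) (k := i) (by omega) (by omega))
      have h2 := map_gaussBinom (expand t ht : ℤ⟦X⟧ →ₐ[ℤ] ℤ⟦X⟧).toRingHom X (2 * n) i
      simp only [AlgHom.toRingHom_eq_coe, RingHom.coe_coe, expand_X] at h2
      rw [map_pow, map_sub, expand_X, h2] at h
      rw [hzw]
      exact (pow_dvd_pow_of_dvd (dvd_pow_self X ht) M).trans h
    have h2 := mul_dvd_mul h1 (pow_natAbs_dvd_thetaTerm hz hw (i - n))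
    rwa [← pow_add, hM] at h2
  refine tendsto_nhds_unique hprod ?_
  have h := hsum.add hdiff
  rw [add_zero] at h
  refine h.congr fun n => ?_
  rw [finite_jacobi_triple_product, ← sum_range_eq_sum_Icc_neg, Finset.mul_sum,
    ← Finset.sum_add_distrib]
  exact Finset.sum_congr rfl fun i _ => by ring

theorem summable_thetaTerm {z w : ℤ⟦X⟧} (hz : X ∣ z) (hw : X ∣ w) :
    Summable (thetaTerm z w) := by
  rw [WithPiTopology.summable_iff_summable_coeff]
  intro d
  refine summable_of_hasFiniteSupport ((Set.finite_Icc (-d : ℤ) d).subset fun j hj => ?_)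
  by_contra hd
  refine hj (X_pow_dvd_iff.mp (pow_natAbs_dvd_thetaTerm hz hw j) d ?_)
  rw [Set.mem_Icc] at hd
  omega

theorem summable_mul_of_summable {ι κ : Type*} {f : ι → ℤ⟦X⟧} {g : κ → ℤ⟦X⟧}
    (hf : Summable f) (hg : Summable g) : Summable fun x : ι × κ => f x.1 * g x.2 := by
  rw [WithPiTopology.summable_iff_summable_coeff] at *
  intro d
  have h1 := fun a => (hf a).hasFiniteSupport_of_discreteTopology
  have h2 := fun a => (hg a).hasFiniteSupport_of_discreteTopology
  refine summable_of_hasFiniteSupport (Set.Finite.subset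
    ((Finset.HasAntidiagonal.antidiagonal d).finite_toSet.biUnion fun a _ => (h1 a.1).prod (h2 a.2))
    fun x hx => ?_)
  rw [Function.mem_support, coeff_mul] at hx
  obtain ⟨a, ha, h⟩ := Finset.exists_ne_zero_of_sum_ne_zero hx
  simp only [Set.mem_iUnion]
  exact ⟨a, ha, left_ne_zero_of_mul h, right_ne_zero_of_mul h⟩

theorem HasSum.mul_powerSeries {ι κ : Type*} {f : ι → ℤ⟦X⟧} {g : κ → ℤ⟦X⟧} {a b : ℤ⟦X⟧}
    (hf : HasSum f a) (hg : HasSum g b) :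
    HasSum (fun x : ι × κ => f x.1 * g x.2) (a * b) :=
  hf.mul hg (summable_mul_of_summable hf.summable hg.summable)

end JacobiTripleProduct

/-! ### Comparing coefficients in residue classes. -/

section Dissection

/-- Only exponents divisible by `m` occur in `expand m hm D`, so the product convolves `D` with each
residue class separately. -/
theorem coeff_expand_mul_eq_of_coeff_eq {m k l : ℕ} (hm : m ≠ 0) (hk : k < m) (hl : l < m)
    {c : ℤ} {A B : ℤ⟦X⟧} (h : ∀ n, coeff (m * n + k) A = c * coeff (m * n + l) B)
    (D : ℤ⟦X⟧) (n : ℕ) :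
    coeff (m * n + k) (expand m hm D * A) = c * coeff (m * n + l) (expand m hm D * B) := by
  have key (r : ℕ) (hr : r < m) (F : ℤ⟦X⟧) : coeff (m * n + r) (expand m hm D * F) =
      ∑ i ∈ Finset.range (n + 1), coeff i D * coeff (m * (n - i) + r) F := by
    rw [coeff_mul, Finset.Nat.sum_antidiagonal_eq_sum_range_succ
      fun i j => coeff i (expand m hm D) * coeff j F]
    symm
    refine Finset.sum_of_injOn (fun i => m * i) ?_ ?_ ?_ ?_
    · intro i _ j _ hij
      exact Nat.eq_of_mul_eq_mul_left (Nat.pos_of_ne_zero hm) hij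
    · intro i hi
      simp only [Finset.coe_range, Set.mem_Iio] at hi ⊢
      have := Nat.mul_le_mul_left m (Nat.lt_succ_iff.mp hi)
      omega
    · intro i hi hi'
      rw [coeff_expand_of_not_dvd, zero_mul]
      rintro ⟨j, rfl⟩
      refine hi' ⟨j, ?_, rfl⟩
      rw [Finset.mem_range] at hi
      rw [Finset.coe_range, Set.mem_Iio]
      by_contra hj
      have := Nat.mul_le_mul_left m (not_lt.mp hj)
      rw [mul_add] at this
      omega
    · intro i hi
      have hi' := Nat.lt_succ_iff.mp (Finset.mem_range.mp hi)
      have := Nat.mul_le_mul_left m hi'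
      rw [coeff_expand_mul, Nat.mul_sub, Nat.sub_add_comm this]
  rw [key k hk, key l hl, Finset.mul_sum]
  exact Finset.sum_congr rfl fun i _ => by rw [h]; ring

/-- `φ` and `ψ` need only be mutually inverse on the fibres `E = m` and `E' = n`. The reflections
below are integral only there. -/
theorem coeff_eq_of_hasSum {ι κ : Type*} {c : ℤ} {s : ι → ℤ} {s' : κ → ℤ} {E : ι → ℕ}
    {E' : κ → ℕ} {A B : ℤ⟦X⟧} (hA : HasSum (fun x => (s x : ℤ⟦X⟧) * X ^ E x) A)
    (hB : HasSum (fun x => (s' x : ℤ⟦X⟧) * X ^ E' x) B) {m n : ℕ} (φ : ι → κ) (ψ : κ → ι)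
    (hφ : ∀ x, E x = m → E' (φ x) = n ∧ ψ (φ x) = x ∧ s x = c * s' (φ x))
    (hψ : ∀ y, E' y = n → E (ψ y) = m ∧ φ (ψ y) = y) :
    coeff m A = c * coeff n B := by
  have hc (s : ℤ) (e d : ℕ) : coeff d ((s : ℤ⟦X⟧) * X ^ e) = if e = d then s else 0 := by
    rw [show (s : ℤ⟦X⟧) = C s by simp, coeff_C_mul, coeff_X_pow]
    simp [eq_comm]
  have h1 := WithPiTopology.hasSum_iff_hasSum_coeff ℤ |>.mp hA m
  have h2 := (WithPiTopology.hasSum_iff_hasSum_coeff ℤ |>.mp hB n).mul_left c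
  simp only [hc] at h1 h2
  refine h1.unique ((hasSum_iff_hasSum_of_ne_zero_bij (fun x => φ x.1) ?_ ?_ ?_).mp h2)
  · rintro ⟨x, hx⟩ ⟨y, hy⟩ hxy
    have hx' : E x = m := by by_contra h; simp [h] at hx
    have hy' : E y = m := by by_contra h; simp [h] at hy
    have := congrArg ψ hxy
    simp only [(hφ x hx').2.1, (hφ y hy').2.1] at this
    exact Subtype.ext this
  · intro y hy
    have hy' : E' y = n := by by_contra h; simp [h] at hy
    obtain ⟨h3, h4⟩ := hψ y hy'
    refine ⟨⟨ψ y, ?_⟩, h4⟩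
    rw [Function.mem_support, if_pos hy'] at hy
    rwa [Function.mem_support, if_pos h3, (hφ _ h3).2.2, h4]
  · rintro ⟨x, hx⟩
    have hx' : E x = m := by by_contra h; simp [h] at hx
    simp only [if_pos hx', if_pos (hφ x hx').1, (hφ x hx').2.2]

end Dissection

/-! ### The products as quadruple theta series. -/

section ThetaProducts

theorem thetaTerm_X_pow (r u : ℕ) (j : ℤ) :
    thetaTerm ((X : ℤ⟦X⟧) ^ r) (X ^ u) j =
      X ^ (r * triangular j + u * triangular (j - 1)) := by
  rw [thetaTerm, ← pow_mul, ← pow_mul, ← pow_add]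

theorem thetaTerm_neg_X_pow (r u : ℕ) (j : ℤ) :
    thetaTerm (-(X : ℤ⟦X⟧) ^ r) (-X ^ u) j =
      ((j.negOnePow : ℤ) : ℤ⟦X⟧) * X ^ (r * triangular j + u * triangular (j - 1)) := by
  have h : (-1 : ℤ⟦X⟧) ^ (triangular j + triangular (j - 1)) = ((j.negOnePow : ℤ) : ℤ⟦X⟧) := by
    have h1 : ((triangular j + triangular (j - 1) : ℕ) : ℤ) = j * j := by
      have h1 := two_mul_triangular j
      have h2 := two_mul_triangular (j - 1)
      push_cast
      linarith
    rcases Int.even_or_odd j with hj | hj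
    · rw [Int.negOnePow_even j hj, Even.neg_one_pow]
      · simp
      · rw [← Int.even_coe_nat, h1]
        exact hj.mul_left j
    · rw [Int.negOnePow_odd j hj, Odd.neg_one_pow]
      · simp
      · rw [← Int.odd_coe_nat, h1]
        exact hj.mul hj
  rw [thetaTerm, neg_pow, neg_pow (X ^ u : ℤ⟦X⟧), ← pow_mul, ← pow_mul, ← h]
  ring

theorem two_mul_theta_exponent {t r : ℕ} (hr : r ≤ t) (j : ℤ) :
    2 * ((r * triangular j + (t - r) * triangular (j - 1) : ℕ) : ℤ) =
      t * (j * j) + (2 * r - t) * j := by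
  have h1 := two_mul_triangular j
  have h2 := two_mul_triangular (j - 1)
  push_cast [Nat.cast_sub hr]
  linear_combination (r : ℤ) * h1 + ((t : ℤ) - r) * h2

theorem hasSum_qPoch₂_neg {t r : ℕ} (hr : 0 < r) (hrt : r < t) :
    ∃ A : ℤ⟦X⟧, qPoch₂ (-(X ^ r)) (-(X ^ (t - r))) (X ^ t) =
        expand t (by omega) gaussLimit * A ∧
      HasSum (fun j : ℤ => X ^ (r * triangular j + (t - r) * triangular (j - 1))) A := by
  have hz : (X : ℤ⟦X⟧) ∣ X ^ r := dvd_pow_self X (by omega)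
  have hw : (X : ℤ⟦X⟧) ∣ X ^ (t - r) := dvd_pow_self X (by omega)
  have hT := (summable_thetaTerm hz hw).hasSum
  refine ⟨_, qPoch₂_eq_gaussLimit_mul (by omega) ?_ hz hw hT, ?_⟩
  · rw [← pow_add]
    congr 1
    omega
  · exact hT.congr_fun fun j => (thetaTerm_X_pow r (t - r) j).symm

theorem hasSum_qPoch₂ {t r : ℕ} (hr : 0 < r) (hrt : r < t) :
    ∃ B : ℤ⟦X⟧, qPoch₂ (X ^ r) (X ^ (t - r)) (X ^ t) =
        expand t (by omega) gaussLimit * B ∧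
      HasSum (fun j : ℤ => ((j.negOnePow : ℤ) : ℤ⟦X⟧) *
        X ^ (r * triangular j + (t - r) * triangular (j - 1))) B := by
  have hz : (X : ℤ⟦X⟧) ∣ -X ^ r := (dvd_pow_self X (by omega)).neg_right
  have hw : (X : ℤ⟦X⟧) ∣ -X ^ (t - r) := (dvd_pow_self X (by omega)).neg_right
  have hT := (summable_thetaTerm hz hw).hasSum
  have hzw : -(X : ℤ⟦X⟧) ^ r * -X ^ (t - r) = X ^ t := by
    rw [neg_mul_neg, ← pow_add]
    congr 1
    omega
  have h := qPoch₂_eq_gaussLimit_mul (by omega) hzw hz hw hT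
  rw [neg_neg, neg_neg] at h
  exact ⟨_, h, hT.congr_fun fun j => (thetaTerm_neg_X_pow r (t - r) j).symm⟩

/-- Twice the exponent `t j (j - 1) / 2 + r j` of the general term of the theta series of
`(-q^r, -q^{t-r}, q^t; q^t)_∞`. -/
def thetaForm (t r j : ℤ) : ℤ := t * (j * j) + (2 * r - t) * j

/-- Twice the exponent of the general term of the quadruple theta series of a product of three
theta series of parameters `t₁, r₁` and one of parameters `t₂, r₂`. -/
def quadForm (t₁ r₁ t₂ r₂ : ℤ) (x : ((ℤ × ℤ) × ℤ) × ℤ) : ℤ :=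
  thetaForm t₁ r₁ x.1.1.1 + thetaForm t₁ r₁ x.1.1.2 + thetaForm t₁ r₁ x.1.2 +
    thetaForm t₂ r₂ x.2

theorem gCoeff_eq_coeff {t r s : ℕ} (hr : 0 < r) (hrt : r < t) (hs : 0 < s) (hst : s < 2 * t) :
    ∃ (A : ℤ⟦X⟧) (E : ((ℤ × ℤ) × ℤ) × ℤ → ℕ),
      (∀ n, gCoeff r s t n = coeff n
        (expand t (by omega) (gaussLimit ^ 3 * expand 2 two_ne_zero gaussLimit) * A)) ∧
      (∀ x, 2 * (E x : ℤ) = quadForm t r (2 * t) s x) ∧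
      HasSum (fun x => ((x.2.negOnePow : ℤ) : ℤ⟦X⟧) * X ^ E x) A := by
  obtain ⟨A, hA, hA'⟩ := hasSum_qPoch₂_neg hr hrt
  obtain ⟨B, hB, hB'⟩ := hasSum_qPoch₂ hs hst
  refine ⟨_, fun x => (r * triangular x.1.1.1 + (t - r) * triangular (x.1.1.1 - 1)) +
    (r * triangular x.1.1.2 + (t - r) * triangular (x.1.1.2 - 1)) +
    (r * triangular x.1.2 + (t - r) * triangular (x.1.2 - 1)) +
    (s * triangular x.2 + (2 * t - s) * triangular (x.2 - 1)), ?_, ?_,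
    (((hA'.mul_powerSeries hA').mul_powerSeries hA').mul_powerSeries hB').congr_fun ?_⟩
  · intro n
    -- The base `2 * t` factor is also a series in `X ^ t`.
    have h := expand_mul t (by omega) 2 two_ne_zero gaussLimit
    simp only [mul_comm t 2] at h
    rw [gCoeff, hA, hB, h]
    congr 1
    rw [map_mul, map_pow]
    ring
  · intro x
    have h1 := two_mul_theta_exponent hrt.le x.1.1.1
    have h2 := two_mul_theta_exponent hrt.le x.1.1.2
    have h3 := two_mul_theta_exponent hrt.le x.1.2
    have h4 := two_mul_theta_exponent hst.le x.2
    rw [quadForm, thetaForm, thetaForm, thetaForm, thetaForm]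
    push_cast at h1 h2 h3 h4 ⊢
    linarith
  · intro x
    ring

theorem hCoeff_eq_coeff {t r s : ℕ} (hr : 0 < r) (hrt : r < t) (hs : 0 < s) (hst : s < 2 * t) :
    ∃ (A : ℤ⟦X⟧) (E : ((ℤ × ℤ) × ℤ) × ℤ → ℕ),
      (∀ n, hCoeff r s t n = coeff n
        (expand t (by omega) (gaussLimit * expand 2 two_ne_zero gaussLimit ^ 3) * A)) ∧
      (∀ x, 2 * (E x : ℤ) = quadForm (2 * t) s t r x) ∧
      HasSum (fun x => (((x.1.1.1 + x.1.1.2 + x.1.2).negOnePow : ℤ) : ℤ⟦X⟧) * X ^ E x) A := by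
  obtain ⟨A, hA, hA'⟩ := hasSum_qPoch₂_neg hr hrt
  obtain ⟨B, hB, hB'⟩ := hasSum_qPoch₂ hs hst
  refine ⟨_, fun x => (s * triangular x.1.1.1 + (2 * t - s) * triangular (x.1.1.1 - 1)) +
    (s * triangular x.1.1.2 + (2 * t - s) * triangular (x.1.1.2 - 1)) +
    (s * triangular x.1.2 + (2 * t - s) * triangular (x.1.2 - 1)) +
    (r * triangular x.2 + (t - r) * triangular (x.2 - 1)), ?_, ?_,
    (((hB'.mul_powerSeries hB').mul_powerSeries hB').mul_powerSeries hA').congr_fun ?_⟩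
  · intro n
    have h := expand_mul t (by omega) 2 two_ne_zero gaussLimit
    simp only [mul_comm t 2] at h
    rw [hCoeff, hA, hB, h]
    congr 1
    rw [map_mul, map_pow]
    ring
  · intro x
    have h1 := two_mul_theta_exponent hst.le x.1.1.1
    have h2 := two_mul_theta_exponent hst.le x.1.1.2
    have h3 := two_mul_theta_exponent hst.le x.1.2
    have h4 := two_mul_theta_exponent hrt.le x.2
    rw [quadForm, thetaForm, thetaForm, thetaForm, thetaForm]
    push_cast at h1 h2 h3 h4 ⊢
    linarith
  · intro x
    simp only [Int.negOnePow_add, Units.val_mul, Int.cast_mul]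
    ring

theorem negOnePow_eq_mul_of_even {a b c : ℤ} (h : Even (a - b - c)) :
    (a.negOnePow : ℤ) = c.negOnePow * b.negOnePow := by
  rw [← Units.val_mul, ← Int.negOnePow_add, (Int.negOnePow_eq_iff a (c + b)).mpr]
  rwa [show a - (c + b) = a - b - c by ring]

/-- A bijection between the lattice points of two quadruple theta series, in fixed residue classes
modulo `t`, that multiplies signs by `(-1) ^ κ` yields an identity of coefficients. -/
theorem gCoeff_eq_of_bij {t r s r' s' k l : ℕ} (hr : 0 < r) (hrt : r < t) (hs : 0 < s)
    (hst : s < 2 * t) (hr' : 0 < r') (hrt' : r' < t) (hs' : 0 < s') (hst' : s' < 2 * t)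
    (hk : k < t) (hl : l < t) (κ : ℤ) (φ ψ : ((ℤ × ℤ) × ℤ) × ℤ → ((ℤ × ℤ) × ℤ) × ℤ)
    (hφ : ∀ x (n : ℤ), quadForm t r (2 * t) s x = 2 * (t * n + k) →
      quadForm t r' (2 * t) s' (φ x) = 2 * (t * n + l) ∧ ψ (φ x) = x ∧
        Even (x.2 - (φ x).2 - κ))
    (hψ : ∀ x (n : ℤ), quadForm t r' (2 * t) s' x = 2 * (t * n + l) →
      quadForm t r (2 * t) s (ψ x) = 2 * (t * n + k) ∧ φ (ψ x) = x) (n : ℕ) :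
    gCoeff r s t (t * n + k) = κ.negOnePow * gCoeff r' s' t (t * n + l) := by
  obtain ⟨A, E, hA, hE, hsum⟩ := gCoeff_eq_coeff hr hrt hs hst
  obtain ⟨A', E', hA', hE', hsum'⟩ := gCoeff_eq_coeff hr' hrt' hs' hst'
  rw [hA, hA']
  refine coeff_expand_mul_eq_of_coeff_eq _ hk hl (fun n => ?_) _ n
  refine coeff_eq_of_hasSum hsum hsum' φ ψ (fun x hx => ?_) fun x hx => ?_
  · obtain ⟨h1, h2, h3⟩ := hφ x n (by rw [← hE, hx]; push_cast; ring)
    rw [← hE'] at h1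
    exact ⟨by zify; linarith, h2, negOnePow_eq_mul_of_even h3⟩
  · obtain ⟨h1, h2⟩ := hψ x n (by rw [← hE', hx]; push_cast; ring)
    rw [← hE] at h1
    exact ⟨by zify; linarith, h2⟩

/-- The analogue of `gCoeff_eq_of_bij` for `hCoeff`. -/
theorem hCoeff_eq_of_bij {t r s r' s' k l : ℕ} (hr : 0 < r) (hrt : r < t) (hs : 0 < s)
    (hst : s < 2 * t) (hr' : 0 < r') (hrt' : r' < t) (hs' : 0 < s') (hst' : s' < 2 * t)
    (hk : k < t) (hl : l < t) (κ : ℤ) (φ ψ : ((ℤ × ℤ) × ℤ) × ℤ → ((ℤ × ℤ) × ℤ) × ℤ)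
    (hφ : ∀ x (n : ℤ), quadForm (2 * t) s t r x = 2 * (t * n + k) →
      quadForm (2 * t) s' t r' (φ x) = 2 * (t * n + l) ∧ ψ (φ x) = x ∧
        Even (x.1.1.1 + x.1.1.2 + x.1.2 - ((φ x).1.1.1 + (φ x).1.1.2 + (φ x).1.2) - κ))
    (hψ : ∀ x (n : ℤ), quadForm (2 * t) s' t r' x = 2 * (t * n + l) →
      quadForm (2 * t) s t r (ψ x) = 2 * (t * n + k) ∧ φ (ψ x) = x) (n : ℕ) :
    hCoeff r s t (t * n + k) = κ.negOnePow * hCoeff r' s' t (t * n + l) := by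
  obtain ⟨A, E, hA, hE, hsum⟩ := hCoeff_eq_coeff hr hrt hs hst
  obtain ⟨A', E', hA', hE', hsum'⟩ := hCoeff_eq_coeff hr' hrt' hs' hst'
  rw [hA, hA']
  refine coeff_expand_mul_eq_of_coeff_eq _ hk hl (fun n => ?_) _ n
  refine coeff_eq_of_hasSum hsum hsum' φ ψ (fun x hx => ?_) fun x hx => ?_
  · obtain ⟨h1, h2, h3⟩ := hφ x n (by rw [← hE, hx]; push_cast; ring)
    rw [← hE'] at h1
    exact ⟨by zify; linarith, h2, negOnePow_eq_mul_of_even h3⟩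
  · obtain ⟨h1, h2⟩ := hψ x n (by rw [← hE', hx]; push_cast; ring)
    rw [← hE] at h1
    exact ⟨by zify; linarith, h2⟩

end ThetaProducts

/-! ### The eight lattice isometries. -/

section LatticeReflections

/-- Reflection in `(1, 1, 1, 1)`. Both classes require `a + b + c + 2 * d ≡ 1` mod 5, so one formula
serves as its own inverse. -/
theorem gCoeff_1_2_5_mul_add_1 (n : ℕ) :
    gCoeff 1 2 5 (5 * n + 1) = gCoeff 2 4 5 (5 * n + 2) := by
  have h := gCoeff_eq_of_bij (t := 5) (r := 1) (s := 2) (r' := 2) (s' := 4) (k := 1) (l := 2)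
    (by decide) (by decide) (by decide) (by decide) (by decide) (by decide) (by decide)
    (by decide) (by decide) (by decide) 0
    (fun x =>
      let m := (x.1.1.1 + x.1.1.2 + x.1.2 + 2 * x.2 - 1) / 5
      (((x.1.1.1 - 2 * m, x.1.1.2 - 2 * m), x.1.2 - 2 * m), x.2 - 2 * m))
    (fun x =>
      let m := (x.1.1.1 + x.1.1.2 + x.1.2 + 2 * x.2 - 1) / 5
      (((x.1.1.1 - 2 * m, x.1.1.2 - 2 * m), x.1.2 - 2 * m), x.2 - 2 * m))
    ?_ ?_ n
  · simpa using h
  · rintro ⟨⟨⟨a, b⟩, c⟩, d⟩ n h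
    simp only [quadForm, thetaForm, Prod.mk.injEq, Int.even_iff] at h ⊢
    push_cast at h ⊢
    -- The squares in `h` have coefficients 5 and 10, so mod 5 it is a linear congruence.
    obtain ⟨m, hm⟩ : ∃ m, (a + b + c) + 2 * d - 1 = 5 * m :=
      ⟨((a + b + c) + 2 * d - 1) / 5, by ring_nf at h; omega⟩
    refine ⟨?_, by omega, by omega⟩
    rw [show (a + b + c + 2 * d - 1) / 5 = m by omega]
    obtain rfl : a = 5 * m + 1 - 2 * d - b - c := by omega
    -- Once `a` is eliminated, the two quadratic forms differ by a constant.
    linear_combination h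
  · rintro ⟨⟨⟨a, b⟩, c⟩, d⟩ n h
    simp only [quadForm, thetaForm, Prod.mk.injEq] at h ⊢
    push_cast at h ⊢
    obtain ⟨m, hm⟩ : ∃ m, (a + b + c) + 2 * d - 1 = 5 * m :=
      ⟨((a + b + c) + 2 * d - 1) / 5, by ring_nf at h; omega⟩
    refine ⟨?_, by omega⟩
    rw [show (a + b + c + 2 * d - 1) / 5 = m by omega]
    obtain rfl : a = 5 * m + 1 - 2 * d - b - c := by omega
    linear_combination h

/-- The negative of the reflection in `(1, 1, 1, 1)`. Sending `d` to `-d + 2 * m + 1` flips its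
parity, hence the minus sign. -/
theorem gCoeff_1_2_5_mul_add_3 (n : ℕ) :
    gCoeff 1 2 5 (5 * n + 3) = -gCoeff 2 4 5 (5 * n + 4) := by
  have h := gCoeff_eq_of_bij (t := 5) (r := 1) (s := 2) (r' := 2) (s' := 4) (k := 3) (l := 4)
    (by decide) (by decide) (by decide) (by decide) (by decide) (by decide) (by decide)
    (by decide) (by decide) (by decide) 1
    (fun x =>
      let m := (x.1.1.1 + x.1.1.2 + x.1.2 + 2 * x.2 - 3) / 5
      (((-x.1.1.1 + 2 * m + 1, -x.1.1.2 + 2 * m + 1), -x.1.2 + 2 * m + 1), -x.2 + 2 * m + 1))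
    (fun x =>
      let m := (x.1.1.1 + x.1.1.2 + x.1.2 + 2 * x.2 - 2) / 5
      (((-x.1.1.1 + 2 * m + 1, -x.1.1.2 + 2 * m + 1), -x.1.2 + 2 * m + 1), -x.2 + 2 * m + 1))
    ?_ ?_ n
  · simpa using h
  · rintro ⟨⟨⟨a, b⟩, c⟩, d⟩ n h
    simp only [quadForm, thetaForm, Prod.mk.injEq, Int.even_iff] at h ⊢
    push_cast at h ⊢
    obtain ⟨m, hm⟩ : ∃ m, (a + b + c) + 2 * d - 3 = 5 * m :=
      ⟨((a + b + c) + 2 * d - 3) / 5, by ring_nf at h; omega⟩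
    refine ⟨?_, by omega, by omega⟩
    rw [show (a + b + c + 2 * d - 3) / 5 = m by omega]
    obtain rfl : a = 5 * m + 3 - 2 * d - b - c := by omega
    linear_combination h
  · rintro ⟨⟨⟨a, b⟩, c⟩, d⟩ n h
    simp only [quadForm, thetaForm, Prod.mk.injEq] at h ⊢
    push_cast at h ⊢
    obtain ⟨m, hm⟩ : ∃ m, (a + b + c) + 2 * d - 2 = 5 * m :=
      ⟨((a + b + c) + 2 * d - 2) / 5, by ring_nf at h; omega⟩
    refine ⟨?_, by omega⟩
    rw [show (a + b + c + 2 * d - 2) / 5 = m by omega]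
    obtain rfl : a = 5 * m + 2 - 2 * d - b - c := by omega
    linear_combination h

/-- Reflection in `(1, 1, 1, -1)`; the next identity uses its negative. -/
theorem gCoeff_1_3_5_mul_add_0 (n : ℕ) :
    gCoeff 1 3 5 (5 * n) = gCoeff 2 1 5 (5 * n) := by
  have h := gCoeff_eq_of_bij (t := 5) (r := 1) (s := 3) (r' := 2) (s' := 1) (k := 0) (l := 0)
    (by decide) (by decide) (by decide) (by decide) (by decide) (by decide) (by decide)
    (by decide) (by decide) (by decide) 0
    (fun x =>
      let m := (x.1.1.1 + x.1.1.2 + x.1.2 - 2 * x.2) / 5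
      (((x.1.1.1 - 2 * m, x.1.1.2 - 2 * m), x.1.2 - 2 * m), x.2 + 2 * m))
    (fun x =>
      let m := (x.1.1.1 + x.1.1.2 + x.1.2 - 2 * x.2) / 5
      (((x.1.1.1 - 2 * m, x.1.1.2 - 2 * m), x.1.2 - 2 * m), x.2 + 2 * m))
    ?_ ?_ n
  · simpa using h
  · rintro ⟨⟨⟨a, b⟩, c⟩, d⟩ n h
    simp only [quadForm, thetaForm, Prod.mk.injEq, Int.even_iff] at h ⊢
    push_cast at h ⊢
    obtain ⟨m, hm⟩ : ∃ m, (a + b + c) - 2 * d = 5 * m :=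
      ⟨((a + b + c) - 2 * d) / 5, by ring_nf at h; omega⟩
    refine ⟨?_, by omega, by omega⟩
    rw [show (a + b + c - 2 * d) / 5 = m by omega]
    obtain rfl : a = 5 * m + 2 * d - b - c := by omega
    linear_combination h
  · rintro ⟨⟨⟨a, b⟩, c⟩, d⟩ n h
    simp only [quadForm, thetaForm, Prod.mk.injEq] at h ⊢
    push_cast at h ⊢
    obtain ⟨m, hm⟩ : ∃ m, (a + b + c) - 2 * d = 5 * m :=
      ⟨((a + b + c) - 2 * d) / 5, by ring_nf at h; omega⟩
    refine ⟨?_, by omega⟩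
    rw [show (a + b + c - 2 * d) / 5 = m by omega]
    obtain rfl : a = 5 * m + 2 * d - b - c := by omega
    linear_combination h

theorem gCoeff_1_3_5_mul_add_2 (n : ℕ) :
    gCoeff 1 3 5 (5 * n + 2) = gCoeff 2 1 5 (5 * n + 2) := by
  have h := gCoeff_eq_of_bij (t := 5) (r := 1) (s := 3) (r' := 2) (s' := 1) (k := 2) (l := 2)
    (by decide) (by decide) (by decide) (by decide) (by decide) (by decide) (by decide)
    (by decide) (by decide) (by decide) 0
    (fun x =>
      let m := (x.1.1.1 + x.1.1.2 + x.1.2 - 2 * x.2 - 2) / 5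
      (((-x.1.1.1 + 2 * m + 1, -x.1.1.2 + 2 * m + 1), -x.1.2 + 2 * m + 1), -x.2 - 2 * m))
    (fun x =>
      let m := (x.1.1.1 + x.1.1.2 + x.1.2 - 2 * x.2 - 1) / 5
      (((-x.1.1.1 + 2 * m + 1, -x.1.1.2 + 2 * m + 1), -x.1.2 + 2 * m + 1), -x.2 - 2 * m))
    ?_ ?_ n
  · simpa using h
  · rintro ⟨⟨⟨a, b⟩, c⟩, d⟩ n h
    simp only [quadForm, thetaForm, Prod.mk.injEq, Int.even_iff] at h ⊢
    push_cast at h ⊢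
    obtain ⟨m, hm⟩ : ∃ m, (a + b + c) - 2 * d - 2 = 5 * m :=
      ⟨((a + b + c) - 2 * d - 2) / 5, by ring_nf at h; omega⟩
    refine ⟨?_, by omega, by omega⟩
    rw [show (a + b + c - 2 * d - 2) / 5 = m by omega]
    obtain rfl : a = 5 * m + 2 + 2 * d - b - c := by omega
    linear_combination h
  · rintro ⟨⟨⟨a, b⟩, c⟩, d⟩ n h
    simp only [quadForm, thetaForm, Prod.mk.injEq] at h ⊢
    push_cast at h ⊢
    obtain ⟨m, hm⟩ : ∃ m, (a + b + c) - 2 * d - 1 = 5 * m :=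
      ⟨((a + b + c) - 2 * d - 1) / 5, by ring_nf at h; omega⟩
    refine ⟨?_, by omega⟩
    rw [show (a + b + c - 2 * d - 1) / 5 = m by omega]
    obtain rfl : a = 5 * m + 1 + 2 * d - b - c := by omega
    linear_combination h

/-- Reflection in `(1, 1, 1, 2)`, then negation of the first three coordinates; the next identity
negates the fourth instead. -/
theorem hCoeff_1_1_5_mul_add_0 (n : ℕ) :
    hCoeff 1 1 5 (5 * n) = hCoeff 2 3 5 (5 * n + 2) := by
  have h := hCoeff_eq_of_bij (t := 5) (r := 1) (s := 1) (r' := 2) (s' := 3) (k := 0) (l := 2)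
    (by decide) (by decide) (by decide) (by decide) (by decide) (by decide) (by decide)
    (by decide) (by decide) (by decide) 0
    (fun x =>
      let m := (x.1.1.1 + x.1.1.2 + x.1.2 + x.2) / 5
      (((-x.1.1.1 + 2 * m, -x.1.1.2 + 2 * m), -x.1.2 + 2 * m), x.2 - 4 * m + 1))
    (fun x =>
      let m := (x.1.1.1 + x.1.1.2 + x.1.2 - x.2 + 1) / 5
      (((-x.1.1.1 + 2 * m, -x.1.1.2 + 2 * m), -x.1.2 + 2 * m), x.2 + 4 * m - 1))
    ?_ ?_ n
  · simpa using h
  · rintro ⟨⟨⟨a, b⟩, c⟩, d⟩ n h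
    simp only [quadForm, thetaForm, Prod.mk.injEq, Int.even_iff] at h ⊢
    push_cast at h ⊢
    obtain ⟨m, hm⟩ : ∃ m, (a + b + c) + d = 5 * m :=
      ⟨((a + b + c) + d) / 5, by ring_nf at h; omega⟩
    refine ⟨?_, by omega, by omega⟩
    rw [show (a + b + c + d) / 5 = m by omega]
    obtain rfl : d = 5 * m - a - b - c := by omega
    linear_combination h
  · rintro ⟨⟨⟨a, b⟩, c⟩, d⟩ n h
    simp only [quadForm, thetaForm, Prod.mk.injEq] at h ⊢
    push_cast at h ⊢
    obtain ⟨m, hm⟩ : ∃ m, (a + b + c) - d + 1 = 5 * m :=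
      ⟨((a + b + c) - d + 1) / 5, by ring_nf at h; omega⟩
    refine ⟨?_, by omega⟩
    rw [show (a + b + c - d + 1) / 5 = m by omega]
    obtain rfl : d = a + b + c + 1 - 5 * m := by omega
    linear_combination h

theorem hCoeff_1_1_5_mul_add_1 (n : ℕ) :
    hCoeff 1 1 5 (5 * n + 1) = hCoeff 2 3 5 (5 * n + 3) := by
  have h := hCoeff_eq_of_bij (t := 5) (r := 1) (s := 1) (r' := 2) (s' := 3) (k := 1) (l := 3)
    (by decide) (by decide) (by decide) (by decide) (by decide) (by decide) (by decide)
    (by decide) (by decide) (by decide) 0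
    (fun x =>
      let m := (x.1.1.1 + x.1.1.2 + x.1.2 + x.2 - 1) / 5
      (((x.1.1.1 - 2 * m, x.1.1.2 - 2 * m), x.1.2 - 2 * m), -x.2 + 4 * m))
    (fun x =>
      let m := (1 - ((x.1.1.1 + x.1.1.2 + x.1.2) - x.2)) / 5
      (((x.1.1.1 + 2 * m, x.1.1.2 + 2 * m), x.1.2 + 2 * m), -x.2 + 4 * m))
    ?_ ?_ n
  · simpa using h
  · rintro ⟨⟨⟨a, b⟩, c⟩, d⟩ n h
    simp only [quadForm, thetaForm, Prod.mk.injEq, Int.even_iff] at h ⊢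
    push_cast at h ⊢
    obtain ⟨m, hm⟩ : ∃ m, (a + b + c) + d - 1 = 5 * m :=
      ⟨((a + b + c) + d - 1) / 5, by ring_nf at h; omega⟩
    refine ⟨?_, by omega, by omega⟩
    rw [show (a + b + c + d - 1) / 5 = m by omega]
    obtain rfl : d = 5 * m + 1 - a - b - c := by omega
    linear_combination h
  · rintro ⟨⟨⟨a, b⟩, c⟩, d⟩ n h
    simp only [quadForm, thetaForm, Prod.mk.injEq] at h ⊢
    push_cast at h ⊢
    obtain ⟨m, hm⟩ : ∃ m, 1 - ((a + b + c) - d) = 5 * m :=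
      ⟨(1 - ((a + b + c) - d)) / 5, by ring_nf at h; omega⟩
    refine ⟨?_, by omega⟩
    rw [show (1 - ((a + b + c) - d)) / 5 = m by omega]
    obtain rfl : d = a + b + c + 5 * m - 1 := by omega
    linear_combination h

/-- Reflection in `(1, 1, 1, -2)`, then negation of the first three coordinates. -/
theorem hCoeff_1_4_5_mul_add_1 (n : ℕ) :
    hCoeff 1 4 5 (5 * n + 1) = hCoeff 2 2 5 (5 * n) := by
  have h := hCoeff_eq_of_bij (t := 5) (r := 1) (s := 4) (r' := 2) (s' := 2) (k := 1) (l := 0)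
    (by decide) (by decide) (by decide) (by decide) (by decide) (by decide) (by decide)
    (by decide) (by decide) (by decide) 0
    (fun x =>
      let m := (x.2 - (x.1.1.1 + x.1.1.2 + x.1.2) - 1) / 5
      (((-x.1.1.1 - 2 * m, -x.1.1.2 - 2 * m), -x.1.2 - 2 * m), x.2 - 4 * m - 1))
    (fun x =>
      let m := (-((x.1.1.1 + x.1.1.2 + x.1.2) + x.2)) / 5
      (((-x.1.1.1 - 2 * m, -x.1.1.2 - 2 * m), -x.1.2 - 2 * m), x.2 + 4 * m + 1))
    ?_ ?_ n
  · simpa using h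
  · rintro ⟨⟨⟨a, b⟩, c⟩, d⟩ n h
    simp only [quadForm, thetaForm, Prod.mk.injEq, Int.even_iff] at h ⊢
    push_cast at h ⊢
    obtain ⟨m, hm⟩ : ∃ m, d - (a + b + c) - 1 = 5 * m :=
      ⟨(d - (a + b + c) - 1) / 5, by ring_nf at h; omega⟩
    refine ⟨?_, by omega, by omega⟩
    rw [show (d - (a + b + c) - 1) / 5 = m by omega]
    obtain rfl : d = 5 * m + 1 + a + b + c := by omega
    linear_combination h
  · rintro ⟨⟨⟨a, b⟩, c⟩, d⟩ n h
    simp only [quadForm, thetaForm, Prod.mk.injEq] at h ⊢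
    push_cast at h ⊢
    obtain ⟨m, hm⟩ : ∃ m, -((a + b + c) + d) = 5 * m :=
      ⟨(-((a + b + c) + d)) / 5, by ring_nf at h; omega⟩
    refine ⟨?_, by omega⟩
    rw [show (-((a + b + c) + d)) / 5 = m by omega]
    obtain rfl : d = -5 * m - a - b - c := by omega
    linear_combination h

/-- Reflection in `(1, 1, 1, -2)`, then negation of the fourth coordinate. Three shifts by the odd
number `2 * m + 1` produce the minus sign. -/
theorem hCoeff_1_4_5_mul_add_2 (n : ℕ) :
    hCoeff 1 4 5 (5 * n + 2) = -hCoeff 2 2 5 (5 * n + 1) := by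
  have h := hCoeff_eq_of_bij (t := 5) (r := 1) (s := 4) (r' := 2) (s' := 2) (k := 2) (l := 1)
    (by decide) (by decide) (by decide) (by decide) (by decide) (by decide) (by decide)
    (by decide) (by decide) (by decide) 1
    (fun x =>
      let m := (x.2 - (x.1.1.1 + x.1.1.2 + x.1.2) - 2) / 5
      (((x.1.1.1 + 2 * m + 1, x.1.1.2 + 2 * m + 1), x.1.2 + 2 * m + 1), -x.2 + 4 * m + 2))
    (fun x =>
      let m := (x.1.1.1 + x.1.1.2 + x.1.2 + x.2 - 3) / 5
      (((x.1.1.1 - 2 * m - 1, x.1.1.2 - 2 * m - 1), x.1.2 - 2 * m - 1), -x.2 + 4 * m + 2))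
    ?_ ?_ n
  · simpa using h
  · rintro ⟨⟨⟨a, b⟩, c⟩, d⟩ n h
    simp only [quadForm, thetaForm, Prod.mk.injEq, Int.even_iff] at h ⊢
    push_cast at h ⊢
    obtain ⟨m, hm⟩ : ∃ m, d - (a + b + c) - 2 = 5 * m :=
      ⟨(d - (a + b + c) - 2) / 5, by ring_nf at h; omega⟩
    refine ⟨?_, by omega, by omega⟩
    rw [show (d - (a + b + c) - 2) / 5 = m by omega]
    obtain rfl : d = 5 * m + 2 + a + b + c := by omega
    linear_combination h
  · rintro ⟨⟨⟨a, b⟩, c⟩, d⟩ n h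
    simp only [quadForm, thetaForm, Prod.mk.injEq] at h ⊢
    push_cast at h ⊢
    obtain ⟨m, hm⟩ : ∃ m, (a + b + c) + d - 3 = 5 * m :=
      ⟨((a + b + c) + d - 3) / 5, by ring_nf at h; omega⟩
    refine ⟨?_, by omega⟩
    rw [show (a + b + c + d - 3) / 5 = m by omega]
    obtain rfl : d = 5 * m + 3 - a - b - c := by omega
    linear_combination h

end LatticeReflections

end

theorem mainTheorem4 (n : ℕ) :
    gCoeff 1 2 5 (5 * n + 1) = gCoeff 2 4 5 (5 * n + 2) ∧
    gCoeff 1 2 5 (5 * n + 3) = -gCoeff 2 4 5 (5 * n + 4) ∧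
    gCoeff 1 3 5 (5 * n) = gCoeff 2 1 5 (5 * n) ∧
    gCoeff 1 3 5 (5 * n + 2) = gCoeff 2 1 5 (5 * n + 2) ∧
    hCoeff 1 1 5 (5 * n) = hCoeff 2 3 5 (5 * n + 2) ∧
    hCoeff 1 1 5 (5 * n + 1) = hCoeff 2 3 5 (5 * n + 3) ∧
    hCoeff 1 4 5 (5 * n + 1) = hCoeff 2 2 5 (5 * n) ∧
    hCoeff 1 4 5 (5 * n + 2) = -hCoeff 2 2 5 (5 * n + 1) := by
  exact ⟨gCoeff_1_2_5_mul_add_1 n, gCoeff_1_2_5_mul_add_3 n, gCoeff_1_3_5_mul_add_0 n,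
    gCoeff_1_3_5_mul_add_2 n, hCoeff_1_1_5_mul_add_0 n, hCoeff_1_1_5_mul_add_1 n,
    hCoeff_1_4_5_mul_add_1 n, hCoeff_1_4_5_mul_add_2 n⟩
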